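/- Let $\mathbb D$ be the open unit disc in $\mathbb C$. Let $H^2(\mathbb D^2)$ be the space of holomorphic functions $f$ on $\mathbb D^2$ with $$\|f\|_2^2:=\sup_{0\le r<1}\int_0^{2\pi}\!\!\int_0^{2\pi}|f(re^{i\theta_1},re^{i\theta_2})|^2\,d\theta_1\,d\theta_2<\infty .$$ A function $f\in H^2(\mathbb D^2)$ is called cyclic if $\{Pf : P\in\mathbb C[Z_1,Z_2]\}$ is dense in $H^2(\mathbb D^2)$. A weight function is a non-increasing function $v:(0,1]\to(0,\infty)$ such that $\lim_{t\to0}v(t)=\infty$ and, for some constant $C>0$, $v(t^2)\le C\,v(t)$ for all $t\in(0,1]$. For $z=(z_1,z_2)\in\mathbb D^2$ put $\delta(z):=\max(1-|z_1|,1-|z_2|)$. Then for every weight function $v$ there exists $f\in H^2(\mathbb D^2)$, without zeros in $\mathbb D^2$, such that $$\log|f(z)|\ge -v(\delta(z))\qquad\text{for all } z\in\mathbb D^2,$$ but $f$ is not cyclic in $H^2(\mathbb D^2)$. -/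

import Mathlib

namespace BidiscHardy

open MeasureTheory Set Filter Topology
open scoped ENNReal

/-- A weight function: a non-increasing function `v` from `(0,1]` to `(0,∞)` with `v(t) → ∞` as
`t → 0⁺` and `v(t²) ≤ C v(t)` on `(0,1]` for some `C > 0`. Values outside `(0,1]` play no role. -/
structure IsWeightFunction (v : ℝ → ℝ) : Prop where
  antitoneOn : AntitoneOn v (Ioc 0 1)
  pos : ∀ t ∈ Ioc (0 : ℝ) 1, 0 < v t
  tendsto_atTop : Tendsto v (𝓝[>] 0) atTop
  sq_le : ∃ C : ℝ, 0 < C ∧ ∀ t ∈ Ioc (0 : ℝ) 1, v (t ^ 2) ≤ C * v t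

/-- The open unit bidisc in `ℂ²`. -/
def bidisc : Set (ℂ × ℂ) := Metric.ball (0 : ℂ) 1 ×ˢ Metric.ball (0 : ℂ) 1

/-- `δ(z) = max (1 - |z₁|, 1 - |z₂|)`. -/
noncomputable def delta (z : ℂ × ℂ) : ℝ := max (1 - ‖z.1‖) (1 - ‖z.2‖)

/-- The integral of `|f|²` over the torus of radius `r`. -/
noncomputable def torusMean (f : ℂ × ℂ → ℂ) (r : ℝ) : ℝ≥0∞ :=
  ∫⁻ θ₁ in Ioc (0 : ℝ) (2 * Real.pi), ∫⁻ θ₂ in Ioc (0 : ℝ) (2 * Real.pi),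
    ‖f ((r : ℂ) * Complex.exp (θ₁ * Complex.I), (r : ℂ) * Complex.exp (θ₂ * Complex.I))‖ₑ ^ 2

/-- The Hardy norm `‖f‖₂`, with value `∞` allowed. -/
noncomputable def hardyNorm (f : ℂ × ℂ → ℂ) : ℝ≥0∞ :=
  (⨆ r ∈ Ico (0 : ℝ) 1, torusMean f r) ^ (1 / 2 : ℝ)

/-- `f ∈ H²(𝔻²)`: holomorphic on the bidisc with finite Hardy norm.
Values of `f` outside the bidisc play no role. -/
structure MemHardy (f : ℂ × ℂ → ℂ) : Prop where
  holomorphic : DifferentiableOn ℂ f bidisc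
  norm_lt_top : hardyNorm f < ∞

/-- The value of a polynomial in two variables at `z`. -/
noncomputable def polyEval (P : MvPolynomial (Fin 2) ℂ) (z : ℂ × ℂ) : ℂ :=
  MvPolynomial.eval ![z.1, z.2] P

/-- `f` is cyclic in `H²(𝔻²)`: it belongs to the space and `ℂ[Z₁,Z₂] f` is dense in it for the
Hardy norm. -/
def IsCyclic (f : ℂ × ℂ → ℂ) : Prop :=
  MemHardy f ∧ ∀ g : ℂ × ℂ → ℂ, MemHardy g → ∀ ε : ℝ≥0∞, 0 < ε →
    ∃ P : MvPolynomial (Fin 2) ℂ, hardyNorm (fun z => polyEval P z * f z - g z) < ε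

end BidiscHardy

namespace BidiscHardy

open MeasureTheory Set Filter Topology Polynomial
open scoped ENNReal

/-! The function is `f(z) = exp(-g(z₁z₂))` with `g` holomorphic on the disc, `0 ≤ Re g(w) ≤ v(1 -
|w|)` and `g(0) = c > 0`. Since `1 - |z₁z₂| ≥ δ(z)` and `v` is non-increasing, the lower bound on
`log|f|` follows. If moreover `|exp(-g)|` tends to 1 in mean along a sequence of circles, then `f`
behaves like a non-constant inner function, and these are never cyclic.

`exists_singular_logarithm` obtains `Re g` as the harmonic extension of a Riesz product `c ∏ (1 +
cos(k_j θ))`. Each factor preserves the value at 0, but shrinks the integral of the square root by a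
fixed ratio, so the boundary values vanish in the limit although `g(0) = c`. Taking `k_j` very large
changes the extension only near the circle, where `v` already exceeds twice the previous stage:
hence a majorant growing arbitrarily slowly is allowed.

`not_isCyclic_of_tendsto_torusInt` pairs `PF - 1` with `1 - a F`, where `a = F(0)`. When `|F| = 1`
on the torus this pairing has mean `-(1 - a²)` for every polynomial `P`, so `PF` stays away from 1.
-/

/-! ### Elementary inequalities and the Riemann–Lebesgue lemma. -/

lemma sqrt_one_add_le {x : ℝ} (h1 : -1 ≤ x) (h2 : x ≤ 1) :
    √(1 + x) ≤ 1 + x / 2 - x ^ 2 / 16 := by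
  rw [Real.sqrt_le_left (by nlinarith)]
  nlinarith [mul_nonneg (sq_nonneg x) (sub_nonneg.2 h2), sq_nonneg (x ^ 2), sq_nonneg x]

/-- With `t = 2 Re G` this converts smallness of the mean of the square root into `|exp(-G)|²` being
near 1 in mean. -/
lemma one_sub_exp_neg_le_sqrt {t : ℝ} (ht : 0 ≤ t) : 1 - Real.exp (-t) ≤ √t := by
  rcases le_total t 1 with h | h
  · have h1 := Real.add_one_le_exp (-t)
    have h2 : t ≤ √t := Real.le_sqrt_of_sq_le (by nlinarith)
    linarith
  · have := Real.exp_pos (-t)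
    have h2 : 1 ≤ √t := Real.one_le_sqrt.2 h
    linarith

/-- Riemann–Lebesgue for cosine coefficients. -/
lemma tendsto_integral_mul_cos {F : ℝ → ℝ} (hF : Continuous F) :
    Tendsto (fun k : ℕ => ∫ θ in (0 : ℝ)..2 * Real.pi, F θ * Real.cos (k * θ)) atTop (𝓝 0) := by
  have hpi := Real.pi_pos
  have h := Real.tendsto_integral_exp_smul_cocompact
    (Set.indicator (Ioc (0 : ℝ) (2 * Real.pi)) (fun θ => (F θ : ℂ)))
  -- `fourierChar` carries a factor `2π`, so the integer frequency `k` is evaluated at `k / (2π)`.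
  have hk : Tendsto (fun k : ℕ => (k : ℝ) / (2 * Real.pi)) atTop (cocompact ℝ) :=
    (tendsto_natCast_atTop_atTop.atTop_div_const (by positivity)).mono_right atTop_le_cocompact
  have h2 := (Complex.continuous_re.tendsto _).comp (h.comp hk)
  simp only [Complex.zero_re] at h2
  refine h2.congr fun k => ?_
  simp only [Function.comp_apply]
  have : (fun θ : ℝ => (Real.fourierChar (-(θ * ((k : ℝ) / (2 * Real.pi)))) •
      Set.indicator (Ioc (0 : ℝ) (2 * Real.pi)) (fun θ => (F θ : ℂ)) θ : ℂ)) =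
      Set.indicator (Ioc (0 : ℝ) (2 * Real.pi))
        (fun θ => Complex.exp (((-(k * θ) : ℝ) : ℂ) * Complex.I) * (F θ : ℂ)) := by
    ext θ
    by_cases hθ : θ ∈ Ioc (0 : ℝ) (2 * Real.pi)
    · simp only [Set.indicator_of_mem hθ, Circle.smul_def, Real.fourierChar_apply, smul_eq_mul]
      congr 4
      field_simp
    · simp [Set.indicator_of_notMem hθ]
  rw [this, integral_indicator measurableSet_Ioc,
    ← intervalIntegral.integral_of_le (by positivity)]
  have hc : Continuous
      (fun θ : ℝ => Complex.exp (((-(k * θ) : ℝ) : ℂ) * Complex.I) * (F θ : ℂ)) := by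
    fun_prop
  have := Complex.reCLM.intervalIntegral_comp_comm
    (hc.intervalIntegrable (μ := volume) 0 (2 * Real.pi))
  rw [← Complex.reCLM_apply, ← this]
  refine intervalIntegral.integral_congr fun θ _ => ?_
  simp only [Complex.reCLM_apply, Complex.mul_re, Complex.ofReal_re, Complex.ofReal_im,
    Complex.exp_ofReal_mul_I_re, Real.cos_neg]
  ring

/-! ### One factor of the Riesz product. -/

/-- The next partial product of a Riesz product, written for the analytic completions: on the unit
circle its real part is that of `G` times `1 + cos ((m + natDegree G) θ)`. -/
noncomputable def rieszStep (G : ℝ[X]) (m : ℕ) : ℝ[X] :=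
  G + C (1 / 2) * (X ^ (m + G.natDegree) * G + X ^ m * G.reverse)

lemma aeval_rieszStep (G : ℝ[X]) (m : ℕ) (z : ℂ) :
    aeval z (rieszStep G m) = aeval z G +
      z ^ m * ((z ^ G.natDegree * aeval z G + aeval z G.reverse) / 2) := by
  simp only [rieszStep, map_add, map_mul, aeval_C, map_pow, aeval_X, pow_add]
  simp
  ring

/-- On the circle `z⁻¹` is the conjugate of `z` and the coefficients are real, so the reversed
polynomial equals `z ^ natDegree` times the conjugate of `G(z)`. The added term is therefore `Re
G(z)` times a pure power of `z`. -/
lemma aeval_rieszStep_re (G : ℝ[X]) (m : ℕ) {z : ℂ} (hz : ‖z‖ = 1) :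
    (aeval z (rieszStep G m)).re = (aeval z G).re * (1 + (z ^ (m + G.natDegree)).re) := by
  have hz0 : z ≠ 0 := by rintro rfl; simp at hz
  have hinv : z⁻¹ = (starRingEnd ℂ) z := by
    rw [Complex.inv_def, Complex.normSq_eq_norm_sq, hz]; simp
  have hrev : aeval z G.reverse = z ^ G.natDegree * (starRingEnd ℂ) (aeval z G) := by
    let _ : Invertible z⁻¹ := invertibleOfNonzero (inv_ne_zero hz0)
    have h := eval₂_reverse_mul_pow (algebraMap ℝ ℂ) z⁻¹ G
    rw [invOf_eq_inv, inv_inv, inv_pow] at h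
    rw [← Polynomial.aeval_conj, ← hinv, aeval_def, aeval_def, ← h]
    field_simp
  have : aeval z G + (starRingEnd ℂ) (aeval z G) = ((2 * (aeval z G).re : ℝ) : ℂ) :=
    Complex.add_conj _
  rw [aeval_rieszStep, hrev]
  have h2 : z ^ m * ((z ^ G.natDegree * aeval z G +
      z ^ G.natDegree * (starRingEnd ℂ) (aeval z G)) / 2) =
      (((aeval z G).re : ℝ) : ℂ) * z ^ (m + G.natDegree) := by
    rw [← mul_add, this, pow_add]; push_cast; ring
  rw [h2, Complex.add_re, Complex.re_ofReal_mul]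
  ring

/-- Maximum principle for the real part of a polynomial. -/
lemma re_aeval_le_of_circle (G : ℝ[X]) {B : ℝ} (h : ∀ z : ℂ, ‖z‖ = 1 → (aeval z G).re ≤ B)
    {z : ℂ} (hz : ‖z‖ ≤ 1) : (aeval z G).re ≤ B := by
  -- The modulus of `exp G` is `exp (Re G)`, so the maximum modulus principle applies.
  have hd : Differentiable ℂ (fun z : ℂ => Complex.exp (aeval z G)) :=
    (Polynomial.differentiable_aeval G).cexp
  have := Complex.norm_le_of_forall_mem_frontier_norm_le (U := Metric.ball (0 : ℂ) 1)
    (C := Real.exp B) Metric.isBounded_ball hd.diffContOnCl (fun w hw => by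
      rw [frontier_ball _ one_ne_zero] at hw
      rw [Complex.norm_exp]
      exact Real.exp_le_exp.2 (h w (by simpa using hw))) (z := z)
    (by rw [closure_ball _ one_ne_zero]; simpa using hz)
  rwa [Complex.norm_exp, Real.exp_le_exp] at this

lemma re_aeval_nonneg_of_circle (G : ℝ[X]) (h : ∀ z : ℂ, ‖z‖ = 1 → 0 ≤ (aeval z G).re)
    {z : ℂ} (hz : ‖z‖ ≤ 1) : 0 ≤ (aeval z G).re := by
  have := re_aeval_le_of_circle (-G) (B := 0) (fun w hw => by simpa using h w hw) hz
  simpa using this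

lemma norm_expI (θ : ℝ) : ‖Complex.exp (θ * Complex.I)‖ = 1 := Complex.norm_exp_ofReal_mul_I θ

lemma continuous_aeval_circle (G : ℝ[X]) :
    Continuous (fun θ : ℝ => (aeval (Complex.exp (θ * Complex.I)) G).re) :=
  Complex.continuous_re.comp ((Polynomial.continuous_aeval G).comp (by fun_prop))

/-- Multiplying by `1 + cos (k θ)` with large `k` reduces the integral of the square root. -/
lemma eventually_integral_sqrt_rieszStep_le (G : ℝ[X])
    (hG : ∀ z : ℂ, ‖z‖ = 1 → 0 ≤ (aeval z G).re) {A : ℝ} (hA : 0 < A)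
    (h : ∫ θ in (0 : ℝ)..2 * Real.pi, √((aeval (Complex.exp (θ * Complex.I)) G).re) ≤ A) :
    ∀ᶠ m : ℕ in atTop, ∫ θ in (0 : ℝ)..2 * Real.pi,
      √((aeval (Complex.exp (θ * Complex.I)) (rieszStep G m)).re) ≤ 63 / 64 * A := by
  set F : ℝ → ℝ := fun θ => √((aeval (Complex.exp (θ * Complex.I)) G).re) with hF
  have hFc : Continuous F := (continuous_aeval_circle G).sqrt
  have hRL := tendsto_integral_mul_cos hFc
  have t1 : Tendsto (fun m : ℕ => m + G.natDegree) atTop atTop := tendsto_add_atTop_nat _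
  have t2 : Tendsto (fun m : ℕ => 2 * (m + G.natDegree)) atTop atTop :=
    tendsto_atTop_mono (fun m => by omega) t1
  have hlim := ((hRL.comp t1).const_mul (1 / 2)).sub ((hRL.comp t2).const_mul (1 / 32))
  simp only [mul_zero, sub_zero, Function.comp_def] at hlim
  filter_upwards [hlim.eventually_le_const (show (0 : ℝ) < A / 64 by positivity)] with m hm
  set k := m + G.natDegree with hk
  -- Writing `cos²` through the double angle, the term `-cos²/16` has constant part `-1/32`. The
  -- harmonics `k` and `2k` integrate to almost nothing, and the allowance `A/64` turns `31/32` into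
  -- `63/64`.
  have hpt : ∀ θ : ℝ, √((aeval (Complex.exp (θ * Complex.I)) (rieszStep G m)).re) ≤
      31 / 32 * F θ + 1 / 2 * (F θ * Real.cos ((k : ℕ) * θ))
        - 1 / 32 * (F θ * Real.cos ((2 * k : ℕ) * θ)) := by
    intro θ
    have hre : (Complex.exp (θ * Complex.I) ^ k).re = Real.cos (k * θ) := by
      rw [← Complex.exp_nat_mul, ← mul_assoc]
      have := Complex.exp_ofReal_mul_I_re (k * θ)
      push_cast at this
      exact this
    rw [aeval_rieszStep_re G m (norm_expI θ), hre, Real.sqrt_mul (hG _ (norm_expI θ))]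
    have hs := sqrt_one_add_le (Real.neg_one_le_cos (k * θ)) (Real.cos_le_one (k * θ))
    have hc2 : Real.cos ((2 * k : ℕ) * θ) = 2 * Real.cos (k * θ) ^ 2 - 1 := by
      rw [← Real.cos_two_mul]; push_cast; ring_nf
    rw [hc2]
    have h0 : 0 ≤ F θ := Real.sqrt_nonneg _
    calc F θ * √(1 + Real.cos (k * θ)) ≤
        F θ * (1 + Real.cos (k * θ) / 2 - Real.cos (k * θ) ^ 2 / 16) := by gcongr
      _ = _ := by ring
  have hmono := intervalIntegral.integral_mono_on (μ := volume) (a := 0) (b := 2 * Real.pi)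
    (by positivity) ((continuous_aeval_circle (rieszStep G m)).sqrt.intervalIntegrable _ _)
    (Continuous.intervalIntegrable (by fun_prop) _ _) (fun θ _ => hpt θ)
  rw [intervalIntegral.integral_sub (Continuous.intervalIntegrable (by fun_prop) _ _)
    (Continuous.intervalIntegrable (by fun_prop) _ _),
    intervalIntegral.integral_add (Continuous.intervalIntegrable (by fun_prop) _ _)
    (Continuous.intervalIntegrable (by fun_prop) _ _)] at hmono
  simp only [intervalIntegral.integral_const_mul] at hmono
  linarith

/-! ### The inductive construction below the weight. -/

/-- A stage of the construction: a polynomial with nonnegative real part on the disc, majorized by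
the weight, whose boundary values are small in mean of order `1 / 2`. -/
structure IsRieszStage (v : ℝ → ℝ) (c : ℝ) (n : ℕ) (G : ℝ[X]) : Prop where
  nonneg : ∀ z : ℂ, ‖z‖ ≤ 1 → 0 ≤ (aeval z G).re
  apply_zero : aeval (0 : ℂ) G = (c : ℂ)
  le_weight : ∀ z : ℂ, ‖z‖ < 1 → (aeval z G).re + c / 2 ^ n ≤ v (1 - ‖z‖)
  integral_sqrt_le : ∫ θ in (0 : ℝ)..2 * Real.pi,
    √((aeval (Complex.exp (θ * Complex.I)) G).re) ≤ 2 * Real.pi * √c * (63 / 64) ^ n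

/-- A radius beyond which the weight leaves room for the next stage, and on which `G` is close to
its boundary values. -/
structure IsStageRadius (v : ℝ → ℝ) (c : ℝ) (n : ℕ) (G : ℝ[X]) (r : ℝ) : Prop where
  nonneg : 0 ≤ r
  lt_one : r < 1
  ge : 1 - 1 / ((n : ℝ) + 1) ≤ r
  room : ∀ z : ℂ, ‖z‖ ≤ 1 → ∀ ρ, r ≤ ρ → ρ < 1 → 2 * (aeval z G).re + c ≤ v (1 - ρ)
  close : ∀ z : ℂ, ‖z‖ = 1 → (aeval (r * z) G).re ≤ (aeval z G).re + 1 / 2 ^ n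

lemma exists_bound_aeval (G : ℝ[X]) : ∃ B : ℝ, ∀ z : ℂ, ‖z‖ ≤ 1 → ‖aeval z G‖ ≤ B := by
  obtain ⟨B, hB⟩ := (isCompact_closedBall (0 : ℂ) 1).exists_bound_of_continuousOn
    (Polynomial.continuous_aeval G).continuousOn
  exact ⟨B, fun z hz => hB z (by simpa using hz)⟩

lemma exists_stageRadius {v : ℝ → ℝ} (hv : IsWeightFunction v) (c : ℝ) (n : ℕ) (G : ℝ[X])
    {s : ℝ} (hs0 : 0 ≤ s) (hs : s < 1) : ∃ r, s ≤ r ∧ IsStageRadius v c n G r := by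
  obtain ⟨B, hB⟩ := exists_bound_aeval G
  have e1 : ∀ᶠ r in 𝓝[<] (1 : ℝ), s ≤ r ∧ 1 - 1 / ((n : ℝ) + 1) ≤ r ∧ r < 1 := by
    have a : ∀ᶠ r in 𝓝[<] (1 : ℝ), s < r := nhdsWithin_le_nhds (lt_mem_nhds hs)
    have b : ∀ᶠ r in 𝓝[<] (1 : ℝ), 1 - 1 / ((n : ℝ) + 1) < r :=
      nhdsWithin_le_nhds (lt_mem_nhds (by simp; positivity))
    filter_upwards [a, b, self_mem_nhdsWithin] with r h1 h2 h3 using ⟨h1.le, h2.le, h3⟩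
  have hsub : Tendsto (fun r : ℝ => 1 - r) (𝓝[<] 1) (𝓝[>] 0) := by
    refine tendsto_nhdsWithin_iff.2 ⟨?_, ?_⟩
    · have : Tendsto (fun r : ℝ => 1 - r) (𝓝 1) (𝓝 (1 - 1)) := by
        exact (continuous_const.sub continuous_id).tendsto 1
      rw [sub_self] at this
      exact this.mono_left nhdsWithin_le_nhds
    · filter_upwards [self_mem_nhdsWithin] with r hr
      simpa using hr
  have e2 := (hv.tendsto_atTop.comp hsub).eventually_ge_atTop (2 * B + c)
  have huc := (isCompact_closedBall (0 : ℂ) 1).uniformContinuousOn_of_continuous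
    (Polynomial.continuous_aeval G).continuousOn
  obtain ⟨δ, hδ, hd⟩ := Metric.uniformContinuousOn_iff.1 huc (1 / 2 ^ n) (by positivity)
  have e3 : ∀ᶠ r in 𝓝[<] (1 : ℝ), 1 - δ < r :=
    nhdsWithin_le_nhds (lt_mem_nhds (by linarith))
  obtain ⟨r, ⟨h1, h2, h3⟩, h4, h5⟩ := (e1.and (e2.and e3)).exists
  have hr0 : 0 ≤ r := hs0.trans h1
  refine ⟨r, h1, hr0, h3, h2, fun z hz ρ hρ hρ1 => ?_, fun z hz => ?_⟩
  · have : v (1 - r) ≤ v (1 - ρ) :=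
      hv.antitoneOn ⟨by linarith, by linarith⟩ ⟨by linarith, by linarith⟩ (by linarith)
    have hb := (Complex.re_le_norm _).trans (hB z hz)
    simp only [Function.comp_apply] at h4
    linarith
  · have hnorm : ‖(r : ℂ) * z‖ = r := by simp [hz, abs_of_nonneg hr0]
    have hdist : dist ((r : ℂ) * z) z < δ := by
      rw [dist_eq_norm]
      have : (r : ℂ) * z - z = ((r - 1 : ℝ) : ℂ) * z := by push_cast; ring
      rw [this, norm_mul, hz, Complex.norm_real, Real.norm_eq_abs, abs_of_neg (by linarith)]
      linarith
    have := hd (r * z) (by simp [hz, abs_of_nonneg hr0, h3.le]) z (by simp [hz]) hdist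
    rw [dist_eq_norm] at this
    have h6 := Complex.re_le_norm (aeval ((r : ℂ) * z) G - aeval z G)
    rw [Complex.sub_re] at h6
    linarith

/-- For `‖z‖ ≤ r` a large power `z ^ m` makes the change negligible, and half of the slack `c / 2 ^
n` pays for it. For `‖z‖ ≥ r` the crude bound `1 + cos ≤ 2` on the circle suffices, because `v` has
room for `2 Re G + c` there. -/
lemma IsRieszStage.exists_next {v : ℝ → ℝ} {c : ℝ} (hc : 0 < c) {n : ℕ} {G : ℝ[X]} {r : ℝ}
    (hG : IsRieszStage v c n G) (hr : IsStageRadius v c n G r) :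
    ∃ G' : ℝ[X], IsRieszStage v c (n + 1) G' ∧
      ∀ z : ℂ, ‖z‖ ≤ r → dist (aeval z G) (aeval z G') ≤ min c 1 / 2 / 2 ^ n := by
  obtain ⟨K, hK⟩ := exists_bound_aeval (C (1 / 2) * (X ^ G.natDegree * G + G.reverse))
  have hκ : 0 < min c 1 / 2 / 2 ^ n := by positivity
  have e1 : ∀ᶠ m : ℕ in atTop, r ^ m * K ≤ min c 1 / 2 / 2 ^ n := by
    have := (tendsto_pow_atTop_nhds_zero_of_lt_one hr.nonneg hr.lt_one).mul_const K
    rw [zero_mul] at this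
    exact this.eventually_le_const hκ
  have e2 := eventually_integral_sqrt_rieszStep_le G (fun z hz => hG.nonneg z hz.le)
    (by have := Real.pi_pos; positivity) hG.integral_sqrt_le
  -- `m ≥ 1` keeps the value at the origin unchanged.
  obtain ⟨m, ⟨h1, h2⟩, hm⟩ := ((e1.and e2).and (eventually_ge_atTop 1)).exists
  have hdist : ∀ z : ℂ, ‖z‖ ≤ r →
      dist (aeval z G) (aeval z (rieszStep G m)) ≤ min c 1 / 2 / 2 ^ n := by
    intro z hz
    have hb := hK z (hz.trans hr.lt_one.le)
    have he : aeval z (rieszStep G m) - aeval z G =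
        z ^ m * aeval z (C (1 / 2) * (X ^ G.natDegree * G + G.reverse)) := by
      rw [aeval_rieszStep]
      simp only [map_add, map_mul, aeval_C, map_pow, aeval_X, Complex.coe_algebraMap]
      push_cast
      ring
    rw [dist_comm, dist_eq_norm, he, norm_mul, norm_pow]
    calc ‖z‖ ^ m * _ ≤ r ^ m * K :=
          mul_le_mul (pow_le_pow_left₀ (norm_nonneg _) hz _) hb (norm_nonneg _)
            (pow_nonneg hr.nonneg _)
      _ ≤ _ := h1
  have hcos : ∀ z : ℂ, ‖z‖ = 1 → |(z ^ (m + G.natDegree)).re| ≤ 1 := fun z hz =>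
    (Complex.abs_re_le_norm _).trans (by simp [hz])
  refine ⟨rieszStep G m, ⟨fun z hz => re_aeval_nonneg_of_circle _ (fun w hw => ?_) hz,
    ?_, fun z hz => ?_, ?_⟩, hdist⟩
  · rw [aeval_rieszStep_re G m hw]
    have := abs_le.1 (hcos w hw)
    exact mul_nonneg (hG.nonneg w hw.le) (by linarith)
  · rw [aeval_rieszStep, hG.apply_zero, zero_pow (by omega)]
    simp
  · rcases le_total ‖z‖ r with h | h
    · have h3 := hdist z h
      rw [dist_comm, dist_eq_norm] at h3
      have h4 := Complex.re_le_norm (aeval z (rieszStep G m) - aeval z G)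
      rw [Complex.sub_re] at h4
      have h5 := hG.le_weight z hz
      have h6 : min c 1 / 2 / 2 ^ n ≤ c / 2 / 2 ^ n := by gcongr; exact min_le_left _ _
      have h7 : c / 2 ^ (n + 1) = c / 2 / 2 ^ n := by rw [pow_succ]; field_simp
      have h8 : c / 2 ^ n = c / 2 / 2 ^ n + c / 2 / 2 ^ n := by ring
      linarith
    · have h3 : (aeval z (rieszStep G m)).re ≤ v (1 - ‖z‖) - c := by
        refine re_aeval_le_of_circle _ (fun w hw => ?_) hz.le
        rw [aeval_rieszStep_re G m hw]
        have h4 := hr.room w hw.le ‖z‖ h hz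
        have h5 := abs_le.1 (hcos w hw)
        have h6 := hG.nonneg w hw.le
        nlinarith
      have h4 : c / 2 ^ (n + 1) ≤ c := div_le_self hc.le (one_le_pow₀ (by norm_num))
      linarith
  · refine h2.trans (le_of_eq ?_)
    ring

lemma isRieszStage_C {v : ℝ → ℝ} (hv : IsWeightFunction v) :
    IsRieszStage v (v 1 / 2) 0 (C (v 1 / 2)) := by
  have h1 := hv.pos 1 (by simp)
  refine ⟨fun z _ => ?_, ?_, fun z hz => ?_, ?_⟩
  · rw [aeval_C, Complex.coe_algebraMap, Complex.ofReal_re]; positivity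
  · rw [aeval_C, Complex.coe_algebraMap]
  · rw [aeval_C, Complex.coe_algebraMap, Complex.ofReal_re]
    have : v 1 ≤ v (1 - ‖z‖) := hv.antitoneOn ⟨by linarith, by linarith [norm_nonneg z]⟩
      (by simp) (by linarith [norm_nonneg z])
    linarith
  · simp only [aeval_C, Complex.coe_algebraMap, Complex.ofReal_re, intervalIntegral.integral_const, sub_zero,
      smul_eq_mul, pow_zero, mul_one, le_refl]

lemma exists_rieszStages {v : ℝ → ℝ} (hv : IsWeightFunction v) :
    ∃ (G : ℕ → ℝ[X]) (r : ℕ → ℝ), Monotone r ∧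
      (∀ n, IsRieszStage v (v 1 / 2) n (G n)) ∧ (∀ n, IsStageRadius v (v 1 / 2) n (G n) (r n)) ∧
      ∀ n, ∀ z : ℂ, ‖z‖ ≤ r n →
        dist (aeval z (G n)) (aeval z (G (n + 1))) ≤ min (v 1 / 2) 1 / 2 / 2 ^ n := by
  have hc : 0 < v 1 / 2 := half_pos (hv.pos 1 (by simp))
  -- A stage is bundled with its radius, since the next stage is chosen relative to that radius.
  let S : ℕ → Type := fun n =>
    {p : ℝ[X] × ℝ // IsRieszStage v (v 1 / 2) n p.1 ∧ IsStageRadius v (v 1 / 2) n p.1 p.2}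
  have hnext : ∀ n (p : S n), ∃ q : S (n + 1), p.1.2 ≤ q.1.2 ∧ ∀ z : ℂ, ‖z‖ ≤ p.1.2 →
      dist (aeval z p.1.1) (aeval z q.1.1) ≤ min (v 1 / 2) 1 / 2 / 2 ^ n := by
    rintro n ⟨⟨G, r⟩, hG, hr⟩
    obtain ⟨G', hG', hd⟩ := hG.exists_next hc hr
    obtain ⟨r', hrr, hr'⟩ := exists_stageRadius hv (v 1 / 2) (n + 1) G' hr.nonneg hr.lt_one
    exact ⟨⟨⟨G', r'⟩, hG', hr'⟩, hrr, hd⟩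
  choose next hle hdist using hnext
  obtain ⟨r₀, -, hr₀⟩ := exists_stageRadius hv (v 1 / 2) 0 (C (v 1 / 2)) le_rfl one_pos
  let T : ∀ n, S n := fun n => Nat.rec ⟨⟨C (v 1 / 2), r₀⟩, isRieszStage_C hv, hr₀⟩ next n
  exact ⟨fun n => (T n).1.1, fun n => (T n).1.2, monotone_nat_of_le_succ fun n => hle n (T n),
    fun n => (T n).2.1, fun n => (T n).2.2, fun n => hdist n (T n)⟩

/-! ### Passage to the limit of the stages. -/

/-- For every weight there is a positive harmonic function on the disc below the weight with zero
boundary values in the sense of convergence in mean along a sequence of circles; it is given here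
as the real part of a holomorphic function. -/
theorem exists_singular_logarithm {v : ℝ → ℝ} (hv : IsWeightFunction v) :
    ∃ g : ℂ → ℂ, DifferentiableOn ℂ g (Metric.ball 0 1) ∧
      (∀ z ∈ Metric.ball (0 : ℂ) 1, 0 ≤ (g z).re ∧ (g z).re ≤ v (1 - ‖z‖)) ∧
      (∃ c : ℝ, 0 < c ∧ g 0 = c) ∧
      ∃ r : ℕ → ℝ, (∀ n, 0 ≤ r n ∧ r n < 1) ∧
        Tendsto (fun n => ∫ θ in (0 : ℝ)..2 * Real.pi,
          (1 - Real.exp (-(2 * (g (r n * Complex.exp (θ * Complex.I))).re)))) atTop (𝓝 0) := by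
  obtain ⟨G, r, hmono, hG, hr, hd⟩ := exists_rieszStages hv
  have hc : 0 < v 1 / 2 := half_pos (hv.pos 1 (by simp))
  set c := v 1 / 2
  set κ := min c 1
  have hκ : κ ≤ 1 := min_le_right _ _
  have hrad : ∀ z : ℂ, ‖z‖ < 1 → ∃ N, ‖z‖ < r N := by
    intro z hz
    obtain ⟨N, hN⟩ := exists_nat_one_div_lt (sub_pos.2 hz)
    exact ⟨N, by have := (hr N).ge; linarith⟩
  -- The geometric estimate at `z` is only available once the radius has passed `‖z‖`, hence the
  -- shift by `N`.
  have hshift : ∀ (z : ℂ) (N : ℕ), ‖z‖ ≤ r N → ∀ k,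
      dist (aeval z (G (k + N))) (aeval z (G (k + 1 + N))) ≤ κ / 2 ^ N / 2 / 2 ^ k := by
    intro z N hz k
    have := hd (k + N) z (hz.trans (hmono (by omega)))
    rw [show k + 1 + N = k + N + 1 by omega]
    refine this.trans (le_of_eq ?_)
    rw [pow_add]; field_simp
  have hconv : ∀ z : ℂ, ‖z‖ < 1 → ∃ l : ℂ, Tendsto (fun n => aeval z (G n)) atTop (𝓝 l) := by
    intro z hz
    obtain ⟨N, hN⟩ := hrad z hz
    obtain ⟨l, hl⟩ := cauchySeq_tendsto_of_complete
      (cauchySeq_of_le_geometric_two (hshift z N hN.le))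
    exact ⟨l, (tendsto_add_atTop_iff_nat N).1 hl⟩
  choose! g hg using hconv
  have hgd : ∀ (z : ℂ) (N : ℕ), ‖z‖ ≤ r N → dist (aeval z (G N)) (g z) ≤ κ / 2 ^ N := by
    intro z N hz
    have := dist_le_of_le_geometric_two_of_tendsto₀ (hshift z N hz)
      ((tendsto_add_atTop_iff_nat N).2 (hg z (hz.trans_lt (hr N).lt_one)))
    simpa using this
  have hdiff : DifferentiableOn ℂ g (Metric.ball 0 1) := by
    have hlu : TendstoLocallyUniformlyOn (fun n z => aeval z (G n)) g atTop
        (Metric.ball (0 : ℂ) 1) := by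
      rw [Metric.tendstoLocallyUniformlyOn_iff]
      intro ε hε z hz
      obtain ⟨N, hN⟩ := hrad z (by simpa using hz)
      refine ⟨Metric.ball 0 (r N), mem_nhdsWithin_of_mem_nhds
        (Metric.isOpen_ball.mem_nhds (by simpa using hN)), ?_⟩
      have hlim : Tendsto (fun n : ℕ => κ / 2 ^ n) atTop (𝓝 0) :=
        tendsto_const_nhds.div_atTop (tendsto_pow_atTop_atTop_of_one_lt (by norm_num))
      filter_upwards [hlim.eventually_lt_const hε, eventually_ge_atTop N] with n h1 h2 y hy
      rw [dist_comm]
      have hy' : ‖y‖ < r N := by simpa using hy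
      exact (hgd y n (hy'.le.trans (hmono h2))).trans_lt h1
    exact hlu.differentiableOn
      (Eventually.of_forall fun n => (Polynomial.differentiable_aeval (G n)).differentiableOn)
      Metric.isOpen_ball
  have hre : ∀ z : ℂ, ‖z‖ < 1 → Tendsto (fun n => (aeval z (G n)).re) atTop (𝓝 (g z).re) :=
    fun z hz => (Complex.continuous_re.tendsto _).comp (hg z hz)
  have hg0 : ∀ z : ℂ, ‖z‖ < 1 → 0 ≤ (g z).re := fun z hz =>
    ge_of_tendsto' (hre z hz) fun n => (hG n).nonneg z hz.le
  refine ⟨g, hdiff, fun z hz => ?_, ⟨c, hc, ?_⟩, r, fun n => ⟨(hr n).nonneg, (hr n).lt_one⟩, ?_⟩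
  · have hz' : ‖z‖ < 1 := by simpa using hz
    refine ⟨hg0 z hz', le_of_tendsto' (hre z hz') fun n => ?_⟩
    have := (hG n).le_weight z hz'
    have h2 : 0 < c / 2 ^ n := by positivity
    linarith
  · refine tendsto_nhds_unique (hg 0 (by simp)) ?_
    simp only [(hG _).apply_zero]
    exact tendsto_const_nhds
  · have hpi := Real.pi_pos
    have hub : ∀ n, ∫ θ in (0 : ℝ)..2 * Real.pi,
        (1 - Real.exp (-(2 * (g (r n * Complex.exp (θ * Complex.I))).re))) ≤
        (2 * Real.pi) * (4 / 2 ^ n) + √2 * (2 * Real.pi * √c * (63 / 64) ^ n) := by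
      intro n
      have hpt : ∀ θ : ℝ, 1 - Real.exp (-(2 * (g (r n * Complex.exp (θ * Complex.I))).re)) ≤
          4 / 2 ^ n + √2 * √((aeval (Complex.exp (θ * Complex.I)) (G n)).re) := by
        intro θ
        set z := Complex.exp (θ * Complex.I)
        have hz : ‖z‖ = 1 := norm_expI θ
        have hzr : ‖(r n : ℂ) * z‖ = r n := by simp [hz, abs_of_nonneg (hr n).nonneg]
        have h1 := hgd (r n * z) n hzr.le
        rw [dist_comm, dist_eq_norm] at h1
        have h2 := Complex.re_le_norm (g (r n * z) - aeval (r n * z) (G n))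
        rw [Complex.sub_re] at h2
        have h3 := (hr n).close z hz
        have h4 : κ / 2 ^ n ≤ 1 / 2 ^ n := by gcongr
        set p := (aeval z (G n)).re
        have hp : 0 ≤ p := (hG n).nonneg z hz.le
        -- One error `1 / 2 ^ n` comes from replacing `g` by `G n` at radius `r n`, the other from
        -- moving out to the circle.
        have h5 : (g (r n * z)).re ≤ p + 2 * (1 / 2 ^ n) := by linarith
        have hε : (0 : ℝ) < 1 / 2 ^ n := by positivity
        have h6 : Real.exp (-(2 * p)) * Real.exp (-(4 * (1 / 2 ^ n))) ≤
            Real.exp (-(2 * (g (r n * z)).re)) := by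
          rw [← Real.exp_add]; exact Real.exp_le_exp.2 (by linarith)
        have h7 := Real.add_one_le_exp (-(4 * (1 / 2 ^ n : ℝ)))
        have h8 := one_sub_exp_neg_le_sqrt (show 0 ≤ 2 * p by positivity)
        rw [Real.sqrt_mul (by norm_num)] at h8
        have h9 : Real.exp (-(2 * p)) ≤ 1 := Real.exp_le_one_iff.2 (by linarith)
        have h10 := Real.exp_pos (-(2 * p))
        have h11 : (4 : ℝ) / 2 ^ n = 4 * (1 / 2 ^ n) := by ring
        rw [h11]
        nlinarith
      have hcont : Continuous fun θ : ℝ =>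
          1 - Real.exp (-(2 * (g (r n * Complex.exp (θ * Complex.I))).re)) := by
        have : Continuous fun θ : ℝ => g (r n * Complex.exp (θ * Complex.I)) :=
          hdiff.continuousOn.comp_continuous (by fun_prop) fun θ => by
            simp only [Metric.mem_ball, dist_zero_right, norm_mul, norm_expI, mul_one,
              Complex.norm_real, Real.norm_eq_abs, abs_of_nonneg (hr n).nonneg]
            exact (hr n).lt_one
        have h2 := Complex.continuous_re.comp this
        exact continuous_const.sub (Real.continuous_exp.comp (continuous_const.mul h2).neg)
      have hsc := (continuous_aeval_circle (G n)).sqrt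
      have hmono := intervalIntegral.integral_mono_on (μ := volume) (a := 0) (b := 2 * Real.pi)
        (by positivity) (hcont.intervalIntegrable _ _)
        (Continuous.intervalIntegrable (by fun_prop) _ _) (fun θ _ => hpt θ)
      rw [intervalIntegral.integral_add (Continuous.intervalIntegrable (by fun_prop) _ _)
        (Continuous.intervalIntegrable (by fun_prop) _ _), intervalIntegral.integral_const_mul,
        intervalIntegral.integral_const, sub_zero, smul_eq_mul] at hmono
      refine hmono.trans ?_
      gcongr
      exact (hG n).integral_sqrt_le
    refine squeeze_zero (fun n => ?_) hub ?_
    · refine intervalIntegral.integral_nonneg (by positivity) fun θ _ => ?_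
      have := hg0 (r n * Complex.exp (θ * Complex.I)) (by
        simp only [norm_mul, norm_expI, mul_one,
              Complex.norm_real, Real.norm_eq_abs, abs_of_nonneg (hr n).nonneg]
        exact (hr n).lt_one)
      have h2 := Real.exp_le_one_iff.2
        (show -(2 * (g (r n * Complex.exp (θ * Complex.I))).re) ≤ 0 by linarith)
      linarith
    · have t1 : Tendsto (fun n : ℕ => (4 : ℝ) / 2 ^ n) atTop (𝓝 0) :=
        tendsto_const_nhds.div_atTop (tendsto_pow_atTop_atTop_of_one_lt (by norm_num))
      have t2 : Tendsto (fun n : ℕ => (63 / 64 : ℝ) ^ n) atTop (𝓝 0) :=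
        tendsto_pow_atTop_nhds_zero_of_lt_one (by norm_num) (by norm_num)
      have := (t1.const_mul (2 * Real.pi)).add
        ((t2.const_mul (2 * Real.pi * √c)).const_mul √2)
      simpa using this

/-! ### Integration over tori and the Hardy norm. -/

/-- The point of the torus of radius `s` with arguments `θ₁`, `θ₂`. -/
noncomputable def torusPoint (s θ₁ θ₂ : ℝ) : ℂ × ℂ :=
  ((s : ℂ) * Complex.exp (θ₁ * Complex.I), (s : ℂ) * Complex.exp (θ₂ * Complex.I))

/-- The integral over the torus of radius `s`. -/
noncomputable def torusInt {E : Type*} [NormedAddCommGroup E] [NormedSpace ℝ E]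
    (s : ℝ) (H : ℂ × ℂ → E) : E :=
  ∫ θ₁ in (0 : ℝ)..2 * Real.pi, ∫ θ₂ in (0 : ℝ)..2 * Real.pi, H (torusPoint s θ₁ θ₂)

lemma norm_mul_expI {s : ℝ} (hs : 0 ≤ s) (θ : ℝ) :
    ‖(s : ℂ) * Complex.exp (θ * Complex.I)‖ = s := by
  rw [norm_mul, norm_expI, mul_one, Complex.norm_real, Real.norm_of_nonneg hs]

lemma torusPoint_mem {s : ℝ} (hs : 0 ≤ s) (hs1 : s < 1) (θ₁ θ₂ : ℝ) :
    torusPoint s θ₁ θ₂ ∈ bidisc := by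
  simp only [torusPoint, bidisc, mem_prod, Metric.mem_ball, dist_zero_right, norm_mul_expI hs]
  exact ⟨hs1, hs1⟩

lemma continuous_torusPoint (s : ℝ) : Continuous fun p : ℝ × ℝ => torusPoint s p.1 p.2 := by
  unfold torusPoint
  fun_prop

lemma continuous_comp_torusPoint {E : Type*} [TopologicalSpace E] {s : ℝ} {H : ℂ × ℂ → E}
    (hs : 0 ≤ s) (hs1 : s < 1) (hH : ContinuousOn H bidisc) :
    Continuous fun p : ℝ × ℝ => H (torusPoint s p.1 p.2) :=
  hH.comp_continuous (continuous_torusPoint s) fun p => torusPoint_mem hs hs1 p.1 p.2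

lemma intervalIntegrable_torus_inner {E : Type*} [NormedAddCommGroup E] {s : ℝ}
    {H : ℂ × ℂ → E} (hs : 0 ≤ s) (hs1 : s < 1) (hH : ContinuousOn H bidisc)
    (θ₁ : ℝ) :
    IntervalIntegrable (fun θ₂ => H (torusPoint s θ₁ θ₂)) volume 0 (2 * Real.pi) :=
  ((continuous_comp_torusPoint hs hs1 hH).comp (by fun_prop : Continuous fun θ₂ : ℝ => (θ₁, θ₂))
    ).intervalIntegrable _ _

section

variable {E : Type*} [NormedAddCommGroup E] [NormedSpace ℝ E] {s : ℝ} {H K : ℂ × ℂ → E}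

lemma intervalIntegrable_torus_outer (hs : 0 ≤ s) (hs1 : s < 1) (hH : ContinuousOn H bidisc) :
    IntervalIntegrable (fun θ₁ => ∫ θ₂ in (0 : ℝ)..2 * Real.pi, H (torusPoint s θ₁ θ₂))
      volume 0 (2 * Real.pi) :=
  (intervalIntegral.continuous_parametric_intervalIntegral_of_continuous'
    (f := fun θ₁ θ₂ => H (torusPoint s θ₁ θ₂)) (continuous_comp_torusPoint hs hs1 hH) _ _
    ).intervalIntegrable _ _

lemma torusInt_add (hs : 0 ≤ s) (hs1 : s < 1) (hH : ContinuousOn H bidisc)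
    (hK : ContinuousOn K bidisc) :
    torusInt s (fun z => H z + K z) = torusInt s H + torusInt s K := by
  unfold torusInt
  rw [← intervalIntegral.integral_add (intervalIntegrable_torus_outer hs hs1 hH)
    (intervalIntegrable_torus_outer hs hs1 hK)]
  refine intervalIntegral.integral_congr fun θ₁ _ => ?_
  exact intervalIntegral.integral_add (intervalIntegrable_torus_inner hs hs1 hH θ₁)
    (intervalIntegrable_torus_inner hs hs1 hK θ₁)

lemma norm_torusInt_le (hs : 0 ≤ s) (hs1 : s < 1) {k : ℂ × ℂ → ℝ}
    (hk : ContinuousOn k bidisc) (h : ∀ z ∈ bidisc, ‖H z‖ ≤ k z) :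
    ‖torusInt s H‖ ≤ torusInt s k := by
  have hpi := Real.pi_pos
  refine intervalIntegral.norm_integral_le_of_norm_le (by positivity)
    (Eventually.of_forall fun θ₁ _ => ?_) (intervalIntegrable_torus_outer hs hs1 hk)
  exact intervalIntegral.norm_integral_le_of_norm_le (by positivity)
    (Eventually.of_forall fun θ₂ _ => h _ (torusPoint_mem hs hs1 θ₁ θ₂))
    (intervalIntegrable_torus_inner hs hs1 hk θ₁)

end

lemma torusInt_conj (s : ℝ) (H : ℂ × ℂ → ℂ) :
    torusInt s (fun z => (starRingEnd ℂ) (H z)) = (starRingEnd ℂ) (torusInt s H) := by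
  simp only [torusInt, intervalIntegral, integral_conj, ← map_sub]

lemma integral_circle_eq {f : ℂ → ℂ} (hf : DifferentiableOn ℂ f (Metric.ball 0 1)) {s : ℝ}
    (hs : 0 ≤ s) (hs1 : s < 1) :
    ∫ θ in (0 : ℝ)..2 * Real.pi, f (s * Complex.exp (θ * Complex.I)) = 2 * Real.pi * f 0 := by
  have hpi := Real.pi_pos
  have hd : DiffContOnCl ℂ f (Metric.ball 0 |s|) := by
    rw [abs_of_nonneg hs]
    exact (hf.mono (Metric.closedBall_subset_ball hs1)).diffContOnCl_ball subset_rfl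
  have := hd.circleAverage
  simp only [Real.circleAverage, circleMap, zero_add, Complex.real_smul] at this
  rw [← this]
  push_cast
  rw [← mul_assoc, mul_inv_cancel₀, one_mul]
  simp [hpi.ne']

lemma torusInt_eq {H : ℂ × ℂ → ℂ} (hH : DifferentiableOn ℂ H bidisc) {s : ℝ}
    (hs : 0 ≤ s) (hs1 : s < 1) : torusInt s H = (2 * Real.pi) * (2 * Real.pi * H 0) := by
  have h1 : ∀ θ₁ : ℝ, ∫ θ₂ in (0 : ℝ)..2 * Real.pi, H (torusPoint s θ₁ θ₂) =
      2 * Real.pi * H (s * Complex.exp (θ₁ * Complex.I), 0) := fun θ₁ => by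
    refine integral_circle_eq (f := fun w => H (s * Complex.exp (θ₁ * Complex.I), w)) ?_ hs hs1
    refine hH.comp (by fun_prop) fun w hw => ⟨?_, hw⟩
    simpa [norm_expI, abs_of_nonneg hs] using hs1
  unfold torusInt
  simp only [h1]
  rw [intervalIntegral.integral_const_mul]
  congr 1
  refine (integral_circle_eq (f := fun w => H (w, 0)) ?_ hs hs1)
  exact hH.comp (by fun_prop) fun w hw => ⟨hw, by simp⟩

/-- A torus integral of a function of the product of the coordinates. -/
lemma torusInt_comp_mul {s r : ℝ} (hr : s * s = r) (k : ℂ → ℝ) :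
    torusInt s (fun z => k (z.1 * z.2)) =
      2 * Real.pi * ∫ θ in (0 : ℝ)..2 * Real.pi, k (r * Complex.exp (θ * Complex.I)) := by
  have hper : Function.Periodic (fun θ : ℝ => k (r * Complex.exp (θ * Complex.I)))
      (2 * Real.pi) := by
    intro θ
    simp only
    congr 2
    have := Complex.exp_periodic (θ * Complex.I)
    rw [← this]
    push_cast
    ring_nf
  have h1 : ∀ θ₁ : ℝ, ∫ θ₂ in (0 : ℝ)..2 * Real.pi,
      k ((torusPoint s θ₁ θ₂).1 * (torusPoint s θ₁ θ₂).2) =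
      ∫ θ in (0 : ℝ)..2 * Real.pi, k (r * Complex.exp (θ * Complex.I)) := fun θ₁ => by
    have h2 : ∀ θ₂ : ℝ, k ((torusPoint s θ₁ θ₂).1 * (torusPoint s θ₁ θ₂).2) =
        (fun θ : ℝ => k (r * Complex.exp (θ * Complex.I))) (θ₁ + θ₂) := fun θ₂ => by
      simp only [torusPoint]
      congr 1
      rw [← hr]
      push_cast
      rw [add_mul, Complex.exp_add]
      ring
    simp only [h2]
    rw [intervalIntegral.integral_comp_add_left
      (fun θ : ℝ => k (r * Complex.exp (θ * Complex.I))), add_zero,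
      hper.intervalIntegral_add_eq θ₁ 0, zero_add]
  unfold torusInt
  simp only [h1]
  simp

lemma enorm_torusInt_le (s : ℝ) (H : ℂ × ℂ → ℂ) :
    ‖torusInt s H‖ₑ ≤ ∫⁻ θ₁ in Ioc (0 : ℝ) (2 * Real.pi), ∫⁻ θ₂ in Ioc (0 : ℝ) (2 * Real.pi),
      ‖H (torusPoint s θ₁ θ₂)‖ₑ := by
  have hpi := Real.pi_pos
  unfold torusInt
  rw [intervalIntegral.integral_of_le (by positivity)]
  refine (enorm_integral_le_lintegral_enorm _).trans (lintegral_mono fun θ₁ => ?_)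
  rw [intervalIntegral.integral_of_le (by positivity)]
  exact enorm_integral_le_lintegral_enorm _

/-- The pairing of `D` with a function bounded by `2`, estimated by the Hardy norm of `D`. -/
lemma norm_torusInt_le_of_hardyNorm {D H : ℂ × ℂ → ℂ} {ε : ℝ} (hε : 0 < ε)
    (hD : hardyNorm D < ENNReal.ofReal ε) {s : ℝ} (hs : 0 ≤ s) (hs1 : s < 1)
    (h : ∀ z ∈ bidisc, ‖H z‖ ≤ 2 * ‖D z‖) :
    ‖torusInt s H‖ ≤ ε + ε * (2 * Real.pi * (2 * Real.pi)) := by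
  have hpi := Real.pi_pos
  have hmean : torusMean D s ≤ ENNReal.ofReal (ε ^ 2) := by
    have h1 : torusMean D s ≤ ⨆ r ∈ Ico (0 : ℝ) 1, torusMean D r :=
      le_iSup₂ (f := fun r (_ : r ∈ Ico (0 : ℝ) 1) => torusMean D r) s ⟨hs, hs1⟩
    have h2 : (⨆ r ∈ Ico (0 : ℝ) 1, torusMean D r) = hardyNorm D ^ 2 := by
      rw [hardyNorm, ← ENNReal.rpow_natCast, ← ENNReal.rpow_mul]
      norm_num
    rw [h2] at h1
    rw [ENNReal.ofReal_pow hε.le]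
    exact h1.trans (pow_le_pow_left' hD.le 2)
  have hpt : ∀ θ₁ θ₂ : ℝ, ‖H (torusPoint s θ₁ θ₂)‖ₑ ≤
      ENNReal.ofReal ε⁻¹ * ‖D (torusPoint s θ₁ θ₂)‖ₑ ^ 2 + ENNReal.ofReal ε := by
    intro θ₁ θ₂
    have h1 := h _ (torusPoint_mem hs hs1 θ₁ θ₂)
    set x := ‖D (torusPoint s θ₁ θ₂)‖ with hx
    -- This weighted arithmetic-geometric inequality replaces Cauchy–Schwarz.
    have h2 : 2 * x ≤ ε⁻¹ * x ^ 2 + ε := by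
      have : ε⁻¹ * x ^ 2 + ε - 2 * x = ε⁻¹ * (x - ε) ^ 2 := by field_simp; ring
      have h3 : 0 ≤ ε⁻¹ * (x - ε) ^ 2 := by positivity
      linarith
    rw [← ofReal_norm, ← ofReal_norm, ← ENNReal.ofReal_pow (norm_nonneg _),
      ← ENNReal.ofReal_mul (by positivity), ← ENNReal.ofReal_add (by positivity) hε.le]
    exact ENNReal.ofReal_le_ofReal (h1.trans h2)
  have key : ‖torusInt s H‖ₑ ≤ ENNReal.ofReal (ε + ε * (2 * Real.pi * (2 * Real.pi))) := by
    calc ‖torusInt s H‖ₑ ≤ _ := enorm_torusInt_le s H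
      _ ≤ ∫⁻ θ₁ in Ioc (0 : ℝ) (2 * Real.pi), ∫⁻ θ₂ in Ioc (0 : ℝ) (2 * Real.pi),
          (ENNReal.ofReal ε⁻¹ * ‖D (torusPoint s θ₁ θ₂)‖ₑ ^ 2 + ENNReal.ofReal ε) :=
        lintegral_mono fun θ₁ => lintegral_mono fun θ₂ => hpt θ₁ θ₂
      _ = ENNReal.ofReal ε⁻¹ * torusMean D s +
          ENNReal.ofReal ε * (ENNReal.ofReal (2 * Real.pi) * ENNReal.ofReal (2 * Real.pi)) := by
        simp only [lintegral_add_right _ measurable_const,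
          lintegral_const_mul' _ _ ENNReal.ofReal_ne_top, lintegral_const,
          Measure.restrict_apply_univ, Real.volume_Ioc, sub_zero]
        rfl
      _ ≤ ENNReal.ofReal ε⁻¹ * ENNReal.ofReal (ε ^ 2) +
          ENNReal.ofReal ε * (ENNReal.ofReal (2 * Real.pi) * ENNReal.ofReal (2 * Real.pi)) := by
        gcongr
      _ = _ := by
        rw [← ENNReal.ofReal_mul (by positivity), ← ENNReal.ofReal_mul (by positivity),
          ← ENNReal.ofReal_mul (by positivity), ← ENNReal.ofReal_add (by positivity)
            (by positivity)]
        congr 2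
        field_simp
  rw [← ofReal_norm] at key
  exact (ENNReal.ofReal_le_ofReal_iff (by positivity)).1 key

lemma memHardy_of_norm_le_one {F : ℂ × ℂ → ℂ} (hF : DifferentiableOn ℂ F bidisc)
    (h : ∀ z ∈ bidisc, ‖F z‖ ≤ 1) : MemHardy F := by
  refine ⟨hF, ?_⟩
  have hle : (⨆ r ∈ Ico (0 : ℝ) 1, torusMean F r) ≤
      ENNReal.ofReal (2 * Real.pi) * ENNReal.ofReal (2 * Real.pi) := by
    refine iSup₂_le fun r hr => ?_
    calc torusMean F r ≤ ∫⁻ θ₁ in Ioc (0 : ℝ) (2 * Real.pi),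
          ∫⁻ θ₂ in Ioc (0 : ℝ) (2 * Real.pi), 1 := by
          refine lintegral_mono fun θ₁ => lintegral_mono fun θ₂ => pow_le_one' ?_ 2
          rw [← ofReal_norm, ENNReal.ofReal_le_one]
          exact h _ (torusPoint_mem hr.1 hr.2 θ₁ θ₂)
      _ = _ := by simp
  exact ENNReal.rpow_lt_top_of_nonneg (by norm_num)
    (hle.trans_lt (ENNReal.mul_lt_top ENNReal.ofReal_lt_top ENNReal.ofReal_lt_top)).ne

lemma differentiable_polyEval (P : MvPolynomial (Fin 2) ℂ) : Differentiable ℂ (polyEval P) := by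
  unfold polyEval
  induction P using MvPolynomial.induction_on with
  | C a => simp
  | add p q hp hq => simp only [map_add]; exact hp.add hq
  | mul_X p i hp =>
    simp only [map_mul, MvPolynomial.eval_X]
    refine hp.mul ?_
    fin_cases i
    · simp
    · simp

lemma exists_bound_polyEval (P : MvPolynomial (Fin 2) ℂ) :
    ∃ B : ℝ, ∀ z ∈ bidisc, ‖polyEval P z‖ ≤ B := by
  obtain ⟨B, hB⟩ := ((isCompact_closedBall (0 : ℂ) 1).prod
    (isCompact_closedBall (0 : ℂ) 1)).exists_bound_of_continuousOn
    (differentiable_polyEval P).continuous.continuousOn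
  exact ⟨B, fun z hz => hB z
    ⟨Metric.ball_subset_closedBall hz.1, Metric.ball_subset_closedBall hz.2⟩⟩

/-! ### Failure of cyclicity. -/

/-- A function bounded by one whose modulus tends to one in mean along a sequence of tori, and with
`0 < F 0 < 1`, is not cyclic. -/
theorem not_isCyclic_of_tendsto_torusInt {F : ℂ × ℂ → ℂ} (hF : DifferentiableOn ℂ F bidisc)
    (h1 : ∀ z ∈ bidisc, ‖F z‖ ≤ 1) {a : ℝ} (ha0 : 0 < a) (ha1 : a < 1) (hFa : F 0 = a)
    {s : ℕ → ℝ} (hs : ∀ n, 0 ≤ s n ∧ s n < 1)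
    (hlim : Tendsto (fun n => torusInt (s n) (fun z => 1 - ‖F z‖ ^ 2)) atTop (𝓝 0)) :
    ¬ IsCyclic F := by
  rintro ⟨-, hcyc⟩
  have hpi := Real.pi_pos
  have hpi3 := Real.pi_gt_three
  -- In the limit `hmain` reads `4ε · 4π² ≤ ε + ε · 4π²`, which is absurd.
  set ε : ℝ := (1 - a ^ 2) / 4 with hεdef
  have hε : 0 < ε := by rw [hεdef]; nlinarith
  obtain ⟨P, hP⟩ := hcyc (fun _ => 1)
    (memHardy_of_norm_le_one (differentiableOn_const _) (by simp))
    (ENNReal.ofReal ε) (ENNReal.ofReal_pos.2 hε)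
  obtain ⟨B, hB⟩ := exists_bound_polyEval P
  have hPd := (differentiable_polyEval P).differentiableOn (s := bidisc)
  have hFc := hF.continuousOn
  have hPc := hPd.continuousOn
  have hmain : ∀ n, (1 - a ^ 2) * (2 * Real.pi * (2 * Real.pi)) ≤
      ε + ε * (2 * Real.pi * (2 * Real.pi)) +
        B * torusInt (s n) (fun z => 1 - ‖F z‖ ^ 2) := by
    intro n
    obtain ⟨hs0, hs1⟩ := hs n
    -- The product of `PF - 1` with the conjugate of `1 - a F` splits into a holomorphic part, an
    -- antiholomorphic part and a multiple of `1 - |F|²`. The first two have means `-1` and `a²`, as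
    -- the `P(0)` terms cancel.
    let H₁ : ℂ × ℂ → ℂ := fun z => polyEval P z * F z - a * polyEval P z - 1
    let H₂ : ℂ × ℂ → ℂ := fun z => a * F z
    let H₃ : ℂ × ℂ → ℂ := fun z => a * polyEval P z * ((1 - ‖F z‖ ^ 2 : ℝ) : ℂ)
    have hd1 : DifferentiableOn ℂ H₁ bidisc := by
      exact ((hPd.mul hF).sub (hPd.const_mul _)).sub_const _
    have hd2 : DifferentiableOn ℂ H₂ bidisc := hF.const_mul _
    have hmc : ContinuousOn (fun z => 1 - ‖F z‖ ^ 2) bidisc := by fun_prop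
    have hc3 : ContinuousOn H₃ bidisc := by
      exact (continuousOn_const.mul hPc).mul (Complex.continuous_ofReal.comp_continuousOn hmc)
    have hc2 : ContinuousOn (fun z => (starRingEnd ℂ) (H₂ z)) bidisc :=
      Complex.continuous_conj.comp_continuousOn hd2.continuousOn
    have hsum : torusInt (s n) (fun z => H₁ z + (starRingEnd ℂ) (H₂ z) + H₃ z) =
        -(((1 - a ^ 2) * (2 * Real.pi * (2 * Real.pi)) : ℝ) : ℂ) + torusInt (s n) H₃ := by
      rw [torusInt_add (H := fun z => H₁ z + (starRingEnd ℂ) (H₂ z)) hs0 hs1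
          (hd1.continuousOn.add hc2) hc3,
        torusInt_add hs0 hs1 hd1.continuousOn hc2, torusInt_conj, torusInt_eq hd1 hs0 hs1,
        torusInt_eq hd2 hs0 hs1]
      simp only [H₁, H₂, hFa, map_mul, Complex.conj_ofReal, map_ofNat]
      push_cast
      ring
    have hpair : ∀ z ∈ bidisc, ‖H₁ z + (starRingEnd ℂ) (H₂ z) + H₃ z‖ ≤
        2 * ‖polyEval P z * F z - 1‖ := by
      intro z hz
      have he : H₁ z + (starRingEnd ℂ) (H₂ z) + H₃ z =
          (1 - a * (starRingEnd ℂ) (F z)) * (polyEval P z * F z - 1) := by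
        have := Complex.mul_conj' (F z)
        simp only [H₁, H₂, H₃, map_mul, Complex.conj_ofReal]
        push_cast
        rw [← this]
        ring
      rw [he, norm_mul]
      gcongr
      refine (norm_sub_le _ _).trans ?_
      rw [norm_one, norm_mul, Complex.norm_real, Real.norm_of_nonneg ha0.le, RCLike.norm_conj]
      have := h1 z hz
      nlinarith [norm_nonneg (F z)]
    have hle := norm_torusInt_le_of_hardyNorm hε hP hs0 hs1 hpair
    have h3 : ‖torusInt (s n) H₃‖ ≤ B * torusInt (s n) (fun z => 1 - ‖F z‖ ^ 2) := by
      have : B * torusInt (s n) (fun z => 1 - ‖F z‖ ^ 2) =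
          torusInt (s n) (fun z => B * (1 - ‖F z‖ ^ 2)) := by
        simp only [torusInt, intervalIntegral.integral_const_mul]
      rw [this]
      refine norm_torusInt_le hs0 hs1 (continuousOn_const.mul hmc) fun z hz => ?_
      have hb := hB z hz
      have hm : 0 ≤ 1 - ‖F z‖ ^ 2 := by nlinarith [h1 z hz, norm_nonneg (F z)]
      simp only [H₃]
      rw [norm_mul, norm_mul, Complex.norm_real, Complex.norm_real, Real.norm_of_nonneg hm,
        Real.norm_of_nonneg ha0.le]
      gcongr
      nlinarith [norm_nonneg (polyEval P z)]
    rw [hsum] at hle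
    have h4 : (0 : ℝ) ≤ (1 - a ^ 2) * (2 * Real.pi * (2 * Real.pi)) := by
      have : 0 ≤ 1 - a ^ 2 := by nlinarith
      positivity
    have h5 := norm_sub_norm_le (((1 - a ^ 2) * (2 * Real.pi * (2 * Real.pi)) : ℝ) : ℂ)
      (torusInt (s n) H₃)
    rw [Complex.norm_real, Real.norm_of_nonneg h4, norm_sub_rev (E := ℂ),
      sub_eq_neg_add (torusInt (s n) H₃)] at h5
    linarith
  have hfin := ge_of_tendsto' ((hlim.const_mul B).const_add
    (ε + ε * (2 * Real.pi * (2 * Real.pi)))) hmain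
  rw [mul_zero, add_zero] at hfin
  have h6 : 1 - a ^ 2 = 4 * ε := by rw [hεdef]; ring
  rw [h6] at hfin
  nlinarith [mul_pos hε (mul_pos hpi hpi), mul_lt_mul_of_pos_left hpi3 hε]

end BidiscHardy

/-! ### Composition with the product of the coordinates. -/

theorem mainTheorem1 (v : ℝ → ℝ) (hv : BidiscHardy.IsWeightFunction v) :
    ∃ f : ℂ × ℂ → ℂ, BidiscHardy.MemHardy f ∧
      (∀ z ∈ BidiscHardy.bidisc,
        f z ≠ 0 ∧ -v (BidiscHardy.delta z) ≤ Real.log ‖f z‖) ∧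
      ¬ BidiscHardy.IsCyclic f := by
  obtain ⟨g, hgd, hg, ⟨c, hc, hg0⟩, r, hr, hlim⟩ := BidiscHardy.exists_singular_logarithm hv
  have hmul : ∀ z ∈ BidiscHardy.bidisc, z.1 * z.2 ∈ Metric.ball (0 : ℂ) 1 := by
    rintro z ⟨h1, h2⟩
    simp only [Metric.mem_ball, dist_zero_right] at h1 h2 ⊢
    rw [norm_mul]
    nlinarith [norm_nonneg z.1, norm_nonneg z.2]
  have hF : DifferentiableOn ℂ (fun z : ℂ × ℂ => Complex.exp (-g (z.1 * z.2)))
      BidiscHardy.bidisc :=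
    (hgd.comp (by fun_prop : DifferentiableOn ℂ (fun z : ℂ × ℂ => z.1 * z.2) _) hmul).neg.cexp
  have hnorm : ∀ z : ℂ × ℂ, ‖Complex.exp (-g (z.1 * z.2))‖ = Real.exp (-(g (z.1 * z.2)).re) :=
    fun z => by rw [Complex.norm_exp, Complex.neg_re]
  have hle : ∀ z ∈ BidiscHardy.bidisc, ‖Complex.exp (-g (z.1 * z.2))‖ ≤ 1 := fun z hz => by
    rw [hnorm, Real.exp_le_one_iff]
    linarith [(hg _ (hmul z hz)).1]
  refine ⟨fun z => Complex.exp (-g (z.1 * z.2)), BidiscHardy.memHardy_of_norm_le_one hF hle,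
    fun z hz => ⟨Complex.exp_ne_zero _, ?_⟩, ?_⟩
  · rw [hnorm, Real.log_exp, neg_le_neg_iff]
    have hb := hmul z hz
    refine (hg _ hb).2.trans ?_
    obtain ⟨h1, h2⟩ := hz
    simp only [Metric.mem_ball, dist_zero_right] at h1 h2 hb
    have h3 := norm_nonneg z.1
    have h4 := norm_nonneg z.2
    have h5 := norm_nonneg (z.1 * z.2)
    refine hv.antitoneOn ⟨lt_max_of_lt_left (by linarith), max_le (by linarith) (by linarith)⟩
      ⟨by linarith, by linarith⟩ (max_le ?_ ?_) <;> rw [norm_mul] <;> nlinarith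
  · refine BidiscHardy.not_isCyclic_of_tendsto_torusInt hF hle (a := Real.exp (-c))
      (Real.exp_pos _) (Real.exp_lt_one_iff.2 (by linarith)) (by simp [hg0])
      -- On the torus of radius `√(r n)` the product `z₁z₂` runs over the circle of radius `r n`.
      (s := fun n => √(r n)) (fun n => ⟨Real.sqrt_nonneg _, ?_⟩) ?_
    · rw [Real.sqrt_lt' one_pos]
      simpa using (hr n).2
    · have := hlim.const_mul (2 * Real.pi)
      rw [mul_zero] at this
      refine this.congr fun n => ?_
      rw [← BidiscHardy.torusInt_comp_mul (Real.mul_self_sqrt (hr n).1)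
        (fun w => 1 - Real.exp (-(2 * (g w).re)))]
      congr 1
      ext z
      rw [hnorm, ← Real.exp_nat_mul]
      congr 2
      push_cast
      ring
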